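/- Let $m\in\mathbb N$ and let $\mathbb R^m$ carry its Euclidean inner product. Let $C_{\mathcal R}(\mathbb R^m)$ be the commutative resolvent algebra, i.e. the C*-subalgebra of the bounded continuous functions $C_b(\mathbb R^m)$ (complex valued, supremum norm) generated by the functions $y\mapsto 1/(i\lambda-x\cdot y)$, for $\lambda\in\mathbb R\setminus\{0\}$ and $x\in\mathbb R^m$. Let $\Delta$ be its Gelfand spectrum: the set of nonzero multiplicative linear functionals $C_{\mathcal R}(\mathbb R^m)\to\mathbb C$ with the weak* topology. Let $\Omega=\{V+w \mid V\subseteq\mathbb R^m \text{ linear},\ w\in V^\perp\}$ be the set of (nonempty) affine subspaces of $\mathbb R^m$. A net $(V_\alpha+w_\alpha)_\alpha$ in $\Omega$ (with $w_\alpha\in V_\alpha^\perp$) is absorbed in $V+w\in\Omega$ (with $w\in V^\perp$) if $P_{V^\perp}w_\alpha\to w$, where $P_{V^\perp}$ is the orthogonal projection onto $V^\perp$, and eventually $V_\alpha\subseteq V$. The net converges to $V+w$ if it is absorbed in $V+w$ and none of its subnets is absorbed in any $\tilde V+\tilde w\subsetneq V+w$. Give $\Omega$ the topology induced by this convergence: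 $U\subseteq\Omega$ is open if every limit of a converging net in $\Omega\setminus U$ lies in $\Omega\setminus U$. For $V\subseteq\mathbb R^m$ linear let $S(V)=\{v\in V\mid\|v\|=1\}$ with the spherical measure if $V\neq\{0\}$, and $S(\{0\})=\{0\}$ with the point mass. Theorem. A net in $\Omega$ converges to $V+w$ with respect to this topology if and only if it converges to $V+w$ in the sense just defined. For every $V+w\in\Omega$ (with $w\in V^\perp$) and $f\in C_{\mathcal R}(\mathbb R^m)$ the limit $f^{V,w}(v)=\lim_{t\to\infty}f(tv+w)$ exists for all $v\in S(V)$, and there is a unique $\chi(V+w)(f)\in\mathbb C$ such that $f^{V,w}(v)=\chi(V+w)(f)$ for almost every $v\in S(V)$. Each $\chi(V+w)$ belongs to $\Delta$, and the map $\chi:\Omega\to\Delta$, $V+w\mapsto\chi(V+w)$, is a homeomorphism. -/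

import Mathlib

open Filter Topology MeasureTheory WeakDual
open scoped BoundedContinuousFunction

noncomputable section

namespace ResolventAlg

/-! ### The commutative resolvent algebra -/

section Algebra

variable (X : Type*) [NormedAddCommGroup X] [InnerProductSpace ℝ X]

variable {X} in
theorem denom_norm_ge (l : ℝ) (x y : X) :
    |l| ≤ ‖Complex.I * (l : ℂ) - ((inner ℝ x y : ℝ) : ℂ)‖ := by
  have h := Complex.abs_im_le_norm (Complex.I * (l : ℂ) - ((inner ℝ x y : ℝ) : ℂ))
  simpa using h

variable {X} in
theorem denom_ne_zero {l : ℝ} (hl : l ≠ 0) (x y : X) :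
    Complex.I * (l : ℂ) - ((inner ℝ x y : ℝ) : ℂ) ≠ 0 :=
  norm_pos_iff.1 ((abs_pos.2 hl).trans_le (denom_norm_ge l x y))

variable {X} in
/-- The bounded continuous function `y ↦ 1 / (i l - x ⬝ y)` on `X`, for real `l ≠ 0` and `x : X`. -/
def resolventFun (l : ℝ) (hl : l ≠ 0) (x : X) : X →ᵇ ℂ :=
  BoundedContinuousFunction.ofNormedAddCommGroup
    (fun y => 1 / (Complex.I * (l : ℂ) - ((inner ℝ x y : ℝ) : ℂ)))
    (by
      refine continuous_const.div ?_ (fun y => denom_ne_zero hl x y)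
      fun_prop)
    (1 / |l|)
    (fun y => by
      rw [norm_div, norm_one]
      exact one_div_le_one_div_of_le (abs_pos.2 hl) (denom_norm_ge l x y))

/-- The commutative resolvent algebra of `X`: the C*-subalgebra of `C_b(X)` generated by the
functions `y ↦ 1 / (i l - x ⬝ y)`. As `i / (i - 0 ⬝ y) = 1`, the unital and the non-unital
C*-subalgebras generated by these functions coincide. -/
def commResolventAlgebra : StarSubalgebra ℂ (X →ᵇ ℂ) :=
  (StarAlgebra.adjoin ℂ
    {f : X →ᵇ ℂ | ∃ (l : ℝ) (hl : l ≠ 0) (x : X), f = resolventFun l hl x}).topologicalClosure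

end Algebra

/-! ### The set of affine subspaces -/

/-- The set `Ω` of (nonempty) affine subspaces of `X`. -/
@[ext]
structure Omega (X : Type*) [NormedAddCommGroup X] [InnerProductSpace ℝ X] where
  /-- the affine subspace itself -/
  space : AffineSubspace ℝ X
  /-- affine subspaces in `Ω` are nonempty -/
  nonempty : Nonempty space

namespace Omega

variable {X : Type*} [NormedAddCommGroup X] [InnerProductSpace ℝ X] [FiniteDimensional ℝ X]

instance (A : Omega X) : Nonempty A.space := A.nonempty

/-- The linear subspace `V` of the affine subspace `V + w`. -/
def dir (A : Omega X) : Submodule ℝ X := A.space.direction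

/-- The vector `w ∈ Vᗮ` of the affine subspace `V + w`, that is, the point of `V + w` closest
to the origin. -/
def foot (A : Omega X) : X := (EuclideanGeometry.orthogonalProjection A.space (0 : X) : X)

theorem foot_mem (A : Omega X) : A.foot ∈ A.space :=
  EuclideanGeometry.orthogonalProjection_mem (0 : X)

theorem foot_mem_orthogonal (A : Omega X) : A.foot ∈ A.dirᗮ := by
  have h := EuclideanGeometry.orthogonalProjection_vsub_mem_direction_orthogonal A.space (0 : X)
  simpa [foot, dir] using h

/-- The affine subspace `V + w`. -/
def ofPair (V : Submodule ℝ X) (w : X) : Omega X :=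
  ⟨AffineSubspace.mk' w V, ⟨⟨w, AffineSubspace.self_mem_mk' w V⟩⟩⟩

theorem dir_ofPair (V : Submodule ℝ X) (w : X) : (ofPair V w).dir = V :=
  AffineSubspace.direction_mk' w V

theorem foot_ofPair {V : Submodule ℝ X} {w : X} (hw : w ∈ Vᗮ) : (ofPair V w).foot = w := by
  have h1 : (ofPair V w).foot - w ∈ V := by
    have h := (ofPair V w).foot_mem
    exact AffineSubspace.mem_mk'.1 h
  have h2 : (ofPair V w).foot - w ∈ Vᗮ := by
    have h := (ofPair V w).foot_mem_orthogonal
    rw [dir_ofPair] at h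
    exact Vᗮ.sub_mem h hw
  exact sub_eq_zero.1 (inner_self_eq_zero.1 (h2 _ h1))

theorem ofPair_dir_foot (A : Omega X) : ofPair A.dir A.foot = A :=
  Omega.ext (AffineSubspace.mk'_eq A.foot_mem)

/-- A net `(V_i + w_i)` in `Ω` is absorbed in `V + w` if the orthogonal projections of the `w_i`
to `Vᗮ` converge to `w`, and eventually `V_i ⊆ V`. -/
def AbsorbedIn {ι : Type} [Preorder ι] (x : ι → Omega X) (A : Omega X) : Prop :=
  Tendsto (fun i => A.dirᗮ.starProjection (x i).foot) atTop (𝓝 A.foot) ∧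
    ∀ᶠ i in atTop, (x i).dir ≤ A.dir

/-- A net in `Ω` converges to `V + w` if it is absorbed in `V + w`, and none of its subnets is
absorbed in an affine subspace that is strictly contained in `V + w`. A subnet of `x : ι → Ω` is a
net `x ∘ φ`, where `φ : κ → ι` is eventually above any given index. -/
def ConvergesTo {ι : Type} [Preorder ι] (x : ι → Omega X) (A : Omega X) : Prop :=
  AbsorbedIn x A ∧
    ∀ (κ : Type) [Preorder κ] [IsDirectedOrder κ] [Nonempty κ] (φ : κ → ι),
      Tendsto φ atTop atTop → ∀ B : Omega X, B.space < A.space → ¬ AbsorbedIn (x ∘ φ) B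

theorem AbsorbedIn.subnet {ι κ : Type} [Preorder ι] [Preorder κ] {x : ι → Omega X} {A : Omega X}
    (h : AbsorbedIn x A) {φ : κ → ι} (hφ : Tendsto φ atTop atTop) : AbsorbedIn (x ∘ φ) A :=
  ⟨h.1.comp hφ, hφ.eventually h.2⟩

theorem ConvergesTo.subnet {ι κ : Type} [Preorder ι] [Preorder κ] {x : ι → Omega X} {A : Omega X}
    (h : ConvergesTo x A) {φ : κ → ι} (hφ : Tendsto φ atTop atTop) : ConvergesTo (x ∘ φ) A :=
  ⟨h.1.subnet hφ, fun κ' _ _ _ ψ hψ B hB => h.2 κ' (φ ∘ ψ) (hφ.comp hψ) B hB⟩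

/-- `U ⊆ Ω` is open if limits of converging nets outside of `U` are outside of `U`. -/
def NetOpen (U : Set (Omega X)) : Prop :=
  ∀ (ι : Type) [Preorder ι] [IsDirectedOrder ι] [Nonempty ι] (x : ι → Omega X) (A : Omega X),
    (∀ i, x i ∉ U) → ConvergesTo x A → A ∉ U

theorem NetOpen.not_frequently {U : Set (Omega X)} (hU : NetOpen U) {ι : Type} [Preorder ι]
    [IsDirectedOrder ι] [Nonempty ι] {x : ι → Omega X} {A : Omega X}
    (hf : ∃ᶠ i in atTop, x i ∉ U) (hx : ConvergesTo x A) : A ∉ U := by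
  rw [frequently_atTop] at hf
  have : Nonempty {i // x i ∉ U} :=
    let ⟨b, _, hb⟩ := hf (Classical.arbitrary ι)
    ⟨⟨b, hb⟩⟩
  have : IsDirectedOrder {i // x i ∉ U} := ⟨fun i j => by
    obtain ⟨k, hik, hjk⟩ := exists_ge_ge i.1 j.1
    obtain ⟨l, hl, hlU⟩ := hf k
    exact ⟨⟨l, hlU⟩, hik.trans hl, hjk.trans hl⟩⟩
  have hφ : Tendsto (Subtype.val : {i // x i ∉ U} → ι) atTop atTop := by
    refine tendsto_atTop.2 fun b => ?_
    obtain ⟨l, hl, hlU⟩ := hf b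
    filter_upwards [eventually_ge_atTop (⟨l, hlU⟩ : {i // x i ∉ U})] with k hk
    exact hl.trans hk
  exact hU _ (x ∘ Subtype.val) A (fun i => i.2) (hx.subnet hφ)

/-- The topology of `Ω` induced by the convergence of nets `ConvergesTo`. -/
instance : TopologicalSpace (Omega X) where
  IsOpen := NetOpen
  isOpen_univ := fun ι _ _ _ x A hx _ =>
    absurd (Set.mem_univ _) (hx (Classical.arbitrary ι))
  isOpen_inter := fun U W hU hW ι _ _ _ x A hx hA hUW => by
    have h : ∃ᶠ i in atTop, x i ∉ U ∨ x i ∉ W :=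
      (Eventually.of_forall fun i => not_and_or.1 (hx i)).frequently
    rcases frequently_or_distrib.1 h with h | h
    · exact hU.not_frequently h hA hUW.1
    · exact hW.not_frequently h hA hUW.2
  isOpen_sUnion := fun S hS ι _ _ _ x A hx hA hAS => by
    obtain ⟨U, hUS, hAU⟩ := hAS
    exact hS U hUS ι x A (fun i hi => hx i ⟨U, hUS, hi⟩) hA hAU

end Omega

/-! ### Limit values at infinity -/

section Directions

variable (V : Type*) [NormedAddCommGroup V] [InnerProductSpace ℝ V]

open scoped Classical in
/-- The space of directions `S(V)`: the unit sphere of `V` if `V ≠ {0}`, and `S({0}) = {0}`. -/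
def directions : Set V :=
  if Subsingleton V then {0} else Metric.sphere 0 1

variable [FiniteDimensional ℝ V] [MeasurableSpace V] [BorelSpace V]

open scoped Classical in
/-- The spherical measure on `S(V)`, as a measure on `V` that is concentrated on `S(V)`; on
`S({0})` it is the point mass. -/
def directionMeasure : Measure V :=
  if Subsingleton V then Measure.dirac 0
  else (volume : Measure V).toSphere.map (Subtype.val : Metric.sphere (0 : V) 1 → V)

end Directions

section Limits

variable {X : Type*} [NormedAddCommGroup X] [InnerProductSpace ℝ X] [FiniteDimensional ℝ X]
  [MeasurableSpace X] [BorelSpace X]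

/-- `z` is the limit value at infinity of `f` along the affine subspace `A = V + w`: the limit
`F v` of `f (t v + w)` as `t → ∞` exists for all `v ∈ S(V)`, and `F v = z` for almost all `v`. -/
def IsLimitValue (f : X → ℂ) (A : Omega X) (z : ℂ) : Prop :=
  ∃ F : A.dir → ℂ,
    (∀ v ∈ directions A.dir,
      Tendsto (fun t : ℝ => f (t • (v : X) + A.foot)) atTop (𝓝 (F v))) ∧
    ∀ᵐ v ∂(directionMeasure A.dir), F v = z

end Limits

end ResolventAlg

end

noncomputable section

namespace ResolventAlg

/-! A character `φ` is determined by its values on the resolvents `1/(il - x·y)`. The resolvent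
relations show that the `x` whose resolvents survive under `φ` form a subspace `W`, and that on `W`
the reciprocals have the form `il - c(x)` with `c` real and linear. By Riesz `c` is the inner
product with some `w ∈ W`, so `φ` has the values `resolventValue` of `Wᗮ + w`
(`exists_resolventValue_eq`). Conversely, along almost every ray in `V + w` a resolvent tends to its
value at `w` if `x ⊥ V` and to `0` otherwise (`isLimitValue_resolventFun`). Thus `χ` is bijective.

Weak* convergence may be tested on resolvents (`tendsto_character_iff`). For `y ∈ Vᗮ` such
convergence expresses absorption in `V + w`. For `y ∉ Vᗮ` it says that the values tend to `0`, and
this fails exactly when some subnet is absorbed in a smaller affine subspace: bounded coordinates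
have convergent subnets. So `χ` matches both notions of net convergence, and as nets detect closures
in `Δ`, it is a homeomorphism. -/

theorem resolventFun_apply {X : Type*} [NormedAddCommGroup X] [InnerProductSpace ℝ X] (l : ℝ)
    (hl : l ≠ 0) (x y : X) :
    resolventFun l hl x y = 1 / (Complex.I * (l : ℂ) - ((inner ℝ x y : ℝ) : ℂ)) := rfl

theorem tendsto_inv_of_tendsto_abs {ι : Type*} {F : Filter ι} {u : ι → ℝ} (l : ℝ)
    (hu : Tendsto (fun i => |u i|) F atTop) :
    Tendsto (fun i => 1 / (Complex.I * (l : ℂ) - (u i : ℂ))) F (𝓝 0) := by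
  simp_rw [one_div]
  refine tendsto_inv₀_cobounded.comp (tendsto_norm_atTop_iff_cobounded.1 ?_)
  refine tendsto_atTop_mono (fun i => ?_) hu
  have h := Complex.abs_re_le_norm (Complex.I * (l : ℂ) - (u i : ℂ))
  simpa using h

open scoped Classical in
/-- The value of the character of `A = V + w` at `y ↦ 1 / (i l - x ⬝ y)`. -/
def resolventValue {X : Type*} [NormedAddCommGroup X] [InnerProductSpace ℝ X]
    [FiniteDimensional ℝ X] (A : Omega X) (l : ℝ) (x : X) : ℂ :=
  if x ∈ A.dirᗮ then 1 / (Complex.I * (l : ℂ) - ((inner ℝ x A.foot : ℝ) : ℂ)) else 0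

/-! ### Null sets of directions -/

section DirectionMeasure

variable (V : Type*) [NormedAddCommGroup V] [InnerProductSpace ℝ V] [FiniteDimensional ℝ V]
  [MeasurableSpace V] [BorelSpace V]

instance directionMeasure_neBot : (ae (directionMeasure V)).NeBot := by
  rw [ae_neBot]
  unfold directionMeasure
  split_ifs with h
  · exact Measure.dirac_ne_zero
  · rw [not_subsingleton_iff_nontrivial] at h
    rw [Ne, Measure.map_eq_zero_iff measurable_subtype_coe.aemeasurable]
    exact Measure.toSphere_ne_zero _

theorem ae_mem_directions : ∀ᵐ v ∂(directionMeasure V), v ∈ directions V := by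
  unfold directionMeasure directions
  split_ifs with h
  · exact (ae_dirac_iff (p := (· ∈ ({0} : Set V))) (measurableSet_singleton _)).2 rfl
  · exact (ae_map_iff (p := (· ∈ Metric.sphere (0 : V) 1)) measurable_subtype_coe.aemeasurable
      Metric.isClosed_sphere.measurableSet).2 (Eventually.of_forall fun v => v.2)

/-- A proper subspace contains almost no direction. -/
theorem ae_directionMeasure_notMem (W : Submodule ℝ V) (hW : W ≠ ⊤) :
    ∀ᵐ v ∂(directionMeasure V), v ∉ W := by
  have hWm : MeasurableSet {v : V | v ∉ W} :=
    (W.closed_of_finiteDimensional).measurableSet.compl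
  unfold directionMeasure
  split_ifs with h
  · exact absurd (Subsingleton.elim _ _) hW
  · rw [ae_map_iff measurable_subtype_coe.aemeasurable hWm, ae_iff]
    have hm : MeasurableSet {a : Metric.sphere (0 : V) 1 | ¬ (a : V) ∉ W} :=
      (measurable_subtype_coe hWm).compl
    -- The spherical measure of a set is a multiple of the volume of the cone over it, and this cone
    -- lies in `W`.
    rw [Measure.toSphere_apply' _ hm]
    have h0 : (volume : Measure V) (W : Set V) = 0 := Measure.addHaar_submodule _ _ hW
    rw [measure_mono_null _ h0, mul_zero]
    rintro _ ⟨r, -, _, ⟨a, ha, rfl⟩, rfl⟩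
    exact W.smul_mem r (not_not.1 ha)

end DirectionMeasure

/-! ### Existence and uniqueness of limit values -/

section LimitValue

variable {X : Type*} [NormedAddCommGroup X] [InnerProductSpace ℝ X] [FiniteDimensional ℝ X]
  [MeasurableSpace X] [BorelSpace X] {A : Omega X}

theorem IsLimitValue.unique {f : X → ℂ} {z z' : ℂ} (h : IsLimitValue f A z)
    (h' : IsLimitValue f A z') : z = z' := by
  obtain ⟨F, hF, hz⟩ := h
  obtain ⟨F', hF', hz'⟩ := h'
  obtain ⟨v, hv, hvz, hvz'⟩ := ((ae_mem_directions A.dir).and (hz.and hz')).exists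
  rw [← hvz, ← hvz']
  exact tendsto_nhds_unique (hF v hv) (hF' v hv)

theorem IsLimitValue.const (c : ℂ) : IsLimitValue (fun _ => c) A c :=
  ⟨fun _ => c, fun _ _ => tendsto_const_nhds, Eventually.of_forall fun _ => rfl⟩

theorem IsLimitValue.add {f g : X → ℂ} {z w : ℂ} (hf : IsLimitValue f A z)
    (hg : IsLimitValue g A w) : IsLimitValue (fun y => f y + g y) A (z + w) := by
  obtain ⟨F, hF, hz⟩ := hf
  obtain ⟨G, hG, hw⟩ := hg
  refine ⟨fun v => F v + G v, fun v hv => (hF v hv).add (hG v hv), ?_⟩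
  filter_upwards [hz, hw] with v h1 h2
  rw [h1, h2]

theorem IsLimitValue.mul {f g : X → ℂ} {z w : ℂ} (hf : IsLimitValue f A z)
    (hg : IsLimitValue g A w) : IsLimitValue (fun y => f y * g y) A (z * w) := by
  obtain ⟨F, hF, hz⟩ := hf
  obtain ⟨G, hG, hw⟩ := hg
  refine ⟨fun v => F v * G v, fun v hv => (hF v hv).mul (hG v hv), ?_⟩
  filter_upwards [hz, hw] with v h1 h2
  rw [h1, h2]

theorem IsLimitValue.star {f : X → ℂ} {z : ℂ} (hf : IsLimitValue f A z) :
    IsLimitValue (fun y => Star.star (f y)) A (Star.star z) := by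
  obtain ⟨F, hF, hz⟩ := hf
  refine ⟨fun v => Star.star (F v), fun v hv => (hF v hv).star, ?_⟩
  filter_upwards [hz] with v h1
  rw [h1]

/-- A uniform limit of functions with limit values has a limit value. -/
theorem exists_isLimitValue_of_tendsto {f : ℕ → X →ᵇ ℂ} {g : X →ᵇ ℂ}
    (hfg : Tendsto f atTop (𝓝 g)) (hf : ∀ n, ∃ z, IsLimitValue (f n) A z) :
    ∃ z, IsLimitValue g A z := by
  choose z F hF hz using hf
  -- Passing to the limit along a ray does not increase the supremum distance, so both `F n v` and
  -- `z n` are Cauchy.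
  have hdist : ∀ v ∈ directions A.dir, ∀ n k, dist (F n v) (F k v) ≤ dist (f n) (f k) :=
    fun v hv n k => le_of_tendsto ((hF n v hv).dist (hF k v hv))
      (Eventually.of_forall fun t => BoundedContinuousFunction.dist_coe_le_dist _)
  have hcauchy : ∀ u : ℕ → ℂ, (∀ n k, dist (u n) (u k) ≤ dist (f n) (f k)) →
      ∃ c, Tendsto u atTop (𝓝 c) := fun u hu => by
    refine cauchySeq_tendsto_of_complete ?_
    have := hfg.cauchySeq
    rw [Metric.cauchySeq_iff] at this ⊢
    intro ε hε
    obtain ⟨N, hN⟩ := this ε hε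
    exact ⟨N, fun n hn k hk => (hu n k).trans_lt (hN n hn k hk)⟩
  have hae : ∀ᵐ v ∂(directionMeasure A.dir), v ∈ directions A.dir ∧ ∀ n, F n v = z n :=
    (ae_mem_directions A.dir).and (ae_all_iff.2 hz)
  obtain ⟨c, hc⟩ := hcauchy z fun n k => by
    obtain ⟨v, hv, hvz⟩ := hae.exists
    rw [← hvz n, ← hvz k]
    exact hdist v hv n k
  have hG : ∀ v : A.dir, ∃ c, v ∈ directions A.dir → Tendsto (fun n => F n v) atTop (𝓝 c) :=
    fun v => by
      by_cases hv : v ∈ directions A.dir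
      · obtain ⟨c, hc⟩ := hcauchy (fun n => F n v) (hdist v hv)
        exact ⟨c, fun _ => hc⟩
      · exact ⟨0, fun h => absurd h hv⟩
  choose G hG using hG
  refine ⟨c, G, fun v hv => ?_, ?_⟩
  · have hu := (BoundedContinuousFunction.tendsto_iff_tendstoUniformly.1 hfg).comp
      (fun t : ℝ => t • (v : X) + A.foot)
    -- Uniform convergence lets the limits in `n` and `t` be interchanged.
    exact hu.tendsto_of_eventually_tendsto (Eventually.of_forall fun n => hF n v hv) (hG v hv)
  · filter_upwards [hae] with v hv
    exact tendsto_nhds_unique (hG v hv.1) (hc.congr fun n => (hv.2 n).symm)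

/-- If `x ⊥ V`, the resolvent is constant on each ray. Otherwise `x·(tv + w)` is unbounded unless
`v` lies in the kernel of `x` on `V`, a proper subspace and hence null. -/
theorem isLimitValue_resolventFun (A : Omega X) (l : ℝ) (hl : l ≠ 0) (x : X) :
    IsLimitValue (resolventFun l hl x) A (resolventValue A l x) := by
  classical
  refine ⟨fun v => if inner ℝ x (v : X) = 0 then
    1 / (Complex.I * (l : ℂ) - ((inner ℝ x A.foot : ℝ) : ℂ)) else 0, fun v _ => ?_, ?_⟩
  · simp_rw [resolventFun_apply, inner_add_right, inner_smul_right]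
    split_ifs with hv
    · simp only [hv, mul_zero, zero_add]
      exact tendsto_const_nhds
    · refine tendsto_inv_of_tendsto_abs l ?_
      rcases lt_or_gt_of_ne hv with hv | hv
      · exact tendsto_abs_atBot_atTop.comp
          (tendsto_atBot_add_const_right _ _ (tendsto_id.atTop_mul_const_of_neg hv))
      · exact tendsto_abs_atTop_atTop.comp
          (tendsto_atTop_add_const_right _ _ (tendsto_id.atTop_mul_const hv))
  · unfold resolventValue
    split_ifs with hx
    · refine Eventually.of_forall fun v => if_pos ?_
      exact (Submodule.mem_orthogonal' _ _).1 hx v v.2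
    · let W : Submodule ℝ A.dir := LinearMap.ker ((innerₛₗ ℝ x).comp A.dir.subtype)
      have hW : W ≠ ⊤ := fun h => hx <| (Submodule.mem_orthogonal' _ _).2 fun v hv => by
        have : (⟨v, hv⟩ : A.dir) ∈ W := h ▸ Submodule.mem_top
        simpa [W] using this
      filter_upwards [ae_directionMeasure_notMem A.dir W hW] with v hv
      exact if_neg fun h => hv (by simpa [W] using h)

theorem exists_isLimitValue (A : Omega X) {f : X →ᵇ ℂ} (hf : f ∈ commResolventAlgebra X) :
    ∃ z, IsLimitValue f A z := by
  obtain ⟨u, hu, huf⟩ := mem_closure_iff_seq_limit.1 hf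
  refine exists_isLimitValue_of_tendsto huf fun n => ?_
  refine StarAlgebra.adjoin_induction (p := fun (g : X →ᵇ ℂ) _ => ∃ z, IsLimitValue g A z)
    ?_ ?_ ?_ ?_ ?_ (hu n)
  · rintro _ ⟨l, hl, x, rfl⟩
    exact ⟨_, isLimitValue_resolventFun A l hl x⟩
  · exact fun r => ⟨r, .const r⟩
  · exact fun _ _ _ _ ⟨z, hz⟩ ⟨w, hw⟩ => ⟨z + w, hz.add hw⟩
  · exact fun _ _ _ _ ⟨z, hz⟩ ⟨w, hw⟩ => ⟨z * w, hz.mul hw⟩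
  · exact fun _ _ ⟨z, hz⟩ => ⟨star z, hz.star⟩

end LimitValue

/-! ### Characters and the resolvent relations -/

section Characters

variable {X : Type*} [NormedAddCommGroup X] [InnerProductSpace ℝ X]

theorem isClosed_commResolventAlgebra :
    IsClosed (commResolventAlgebra X : Set (X →ᵇ ℂ)) :=
  StarSubalgebra.isClosed_topologicalClosure _

instance : CompleteSpace (commResolventAlgebra X) :=
  isClosed_commResolventAlgebra.completeSpace_coe

theorem character_star (φ : characterSpace ℂ (commResolventAlgebra X))
    (f : commResolventAlgebra X) : φ (star f) = star (φ f) := by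
  have := isClosed_commResolventAlgebra (X := X)
  exact map_star φ f

/-- The generators of the commutative resolvent algebra. -/
def resolventGen (l : ℝ) (hl : l ≠ 0) (x : X) : commResolventAlgebra X :=
  ⟨resolventFun l hl x,
    StarSubalgebra.le_topologicalClosure _ (StarAlgebra.subset_adjoin _ _ ⟨l, hl, x, rfl⟩)⟩

theorem commResolventAlgebra_ext_iff {f g : commResolventAlgebra X} :
    f = g ↔ ∀ y, (f : X →ᵇ ℂ) y = (g : X →ᵇ ℂ) y := by
  rw [← Subtype.coe_inj, DFunLike.ext_iff]

/-- This is `1/a · 1/b = 1/(a+b) · (1/a + 1/b)` for the two denominators. It makes the surviving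
directions closed under addition and the coordinate of a character additive. -/
theorem resolventGen_mul {l k : ℝ} (hl : l ≠ 0) (hk : k ≠ 0) (hlk : l + k ≠ 0) (x z : X) :
    resolventGen l hl x * resolventGen k hk z =
      resolventGen (l + k) hlk (x + z) * (resolventGen l hl x + resolventGen k hk z) := by
  refine commResolventAlgebra_ext_iff.2 fun y => ?_
  change resolventFun l hl x y * resolventFun k hk z y = resolventFun (l + k) hlk (x + z) y *
    (resolventFun l hl x y + resolventFun k hk z y)
  have h1 := denom_ne_zero hl x y
  have h2 := denom_ne_zero hk z y
  have h3 := denom_ne_zero hlk (x + z) y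
  simp only [resolventFun_apply]
  rw [div_add_div _ _ h1 h2, div_mul_div_comm, div_mul_div_comm, div_eq_div_iff
    (mul_ne_zero h1 h2) (mul_ne_zero h3 (mul_ne_zero h1 h2)), inner_add_left]
  push_cast
  ring

/-- The resolvent identity: whether a character kills the resolvent in direction `x` does not depend
on `l`. -/
theorem resolventGen_resolvent {l k : ℝ} (hl : l ≠ 0) (hk : k ≠ 0) (x : X) :
    resolventGen l hl x = resolventGen k hk x +
      (Complex.I * (k - l)) • (resolventGen l hl x * resolventGen k hk x) := by
  refine commResolventAlgebra_ext_iff.2 fun y => ?_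
  change resolventFun l hl x y = resolventFun k hk x y +
    (Complex.I * (k - l)) • (resolventFun l hl x y * resolventFun k hk x y)
  have h1 := denom_ne_zero hl x y
  have h2 := denom_ne_zero hk x y
  simp only [resolventFun_apply, smul_eq_mul]
  field_simp
  ring

theorem resolventGen_smul {l s : ℝ} (hl : l ≠ 0) (hs : s ≠ 0) (x : X) :
    resolventGen l hl x = (s : ℂ) • resolventGen (s * l) (mul_ne_zero hs hl) (s • x) := by
  refine commResolventAlgebra_ext_iff.2 fun y => ?_
  change resolventFun l hl x y = (s : ℂ) • resolventFun (s * l) (mul_ne_zero hs hl) (s • x) y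
  have h1 := denom_ne_zero hl x y
  have h2 := denom_ne_zero (mul_ne_zero hs hl) (s • x) y
  simp only [resolventFun_apply, smul_eq_mul]
  rw [mul_one_div, div_eq_div_iff h1 h2, real_inner_smul_left]
  push_cast
  ring

theorem resolventGen_zero {l : ℝ} (hl : l ≠ 0) :
    resolventGen l hl (0 : X) = (1 / (Complex.I * l)) • (1 : commResolventAlgebra X) := by
  refine commResolventAlgebra_ext_iff.2 fun y => ?_
  change resolventFun l hl 0 y = (1 / (Complex.I * l)) • (1 : ℂ)
  simp [resolventFun_apply]

theorem star_resolventGen {l : ℝ} (hl : l ≠ 0) (x : X) :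
    star (resolventGen l hl x) = resolventGen (-l) (neg_ne_zero.2 hl) x := by
  refine commResolventAlgebra_ext_iff.2 fun y => ?_
  change star (resolventFun l hl x y) = resolventFun (-l) (neg_ne_zero.2 hl) x y
  simp [resolventFun_apply]

theorem character_ext {φ ψ : characterSpace ℂ (commResolventAlgebra X)}
    (h : ∀ (l : ℝ) (hl : l ≠ 0) (x : X), φ (resolventGen l hl x) = ψ (resolventGen l hl x)) :
    φ = ψ := by
  have key : ∀ (f : X →ᵇ ℂ) (hf : f ∈ StarAlgebra.adjoin ℂ
      {f : X →ᵇ ℂ | ∃ (l : ℝ) (hl : l ≠ 0) (x : X), f = resolventFun l hl x}),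
      φ ⟨f, StarSubalgebra.le_topologicalClosure _ hf⟩ =
        ψ ⟨f, StarSubalgebra.le_topologicalClosure _ hf⟩ := by
    intro f hf
    refine StarAlgebra.adjoin_induction (p := fun (f : X →ᵇ ℂ) hf =>
      φ ⟨f, StarSubalgebra.le_topologicalClosure _ hf⟩ =
        ψ ⟨f, StarSubalgebra.le_topologicalClosure _ hf⟩) ?_ ?_ ?_ ?_ ?_ hf
    · rintro _ ⟨l, hl, x, rfl⟩
      exact h l hl x
    · intro r
      exact (AlgHomClass.commutes φ r).trans (AlgHomClass.commutes ψ r).symm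
    · intro f g hf hg h1 h2
      have := congrArg₂ (· + ·) h1 h2
      simp only [← map_add] at this
      exact this
    · intro f g hf hg h1 h2
      have := congrArg₂ (· * ·) h1 h2
      simp only [← map_mul] at this
      exact this
    · intro f hf h1
      have := congrArg star h1
      simp only [← character_star] at this
      exact this
  have hc : IsClosed {f : commResolventAlgebra X | φ f = ψ f} :=
    isClosed_eq (map_continuous φ) (map_continuous ψ)
  ext ⟨f, hf⟩
  obtain ⟨u, hu, huf⟩ := mem_closure_iff_seq_limit.1 hf
  let v : ℕ → commResolventAlgebra X := fun n =>
    ⟨u n, StarSubalgebra.le_topologicalClosure _ (hu n)⟩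
  have hv : Tendsto v atTop (𝓝 ⟨f, hf⟩) := tendsto_subtype_rng.2 huf
  exact hc.mem_of_tendsto hv (Eventually.of_forall fun n => key (u n) (hu n))

/-- The character space is compact, so the continuous injection given by evaluation at the
generators is a closed embedding into a product. -/
theorem tendsto_character_iff {ι : Type*} {F : Filter ι}
    {φ : ι → characterSpace ℂ (commResolventAlgebra X)}
    {ψ : characterSpace ℂ (commResolventAlgebra X)} :
    Tendsto φ F (𝓝 ψ) ↔ ∀ (l : ℝ) (hl : l ≠ 0) (x : X),
      Tendsto (fun i => φ i (resolventGen l hl x)) F (𝓝 (ψ (resolventGen l hl x))) := by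
  let e : characterSpace ℂ (commResolventAlgebra X) → ({l : ℝ // l ≠ 0} × X) → ℂ :=
    fun φ p => φ (resolventGen p.1.1 p.1.2 p.2)
  have he : Continuous e := continuous_pi fun p =>
    (WeakDual.eval_continuous _).comp continuous_subtype_val
  have hi : Function.Injective e := fun φ ψ h => character_ext fun l hl x =>
    congrFun h (⟨l, hl⟩, x)
  rw [(he.isClosedEmbedding hi).isEmbedding.tendsto_nhds_iff, tendsto_pi_nhds]
  exact ⟨fun h l hl x => h (⟨l, hl⟩, x), fun h p => h p.1.1 p.1.2 p.2⟩

theorem character_resolventGen_eq_zero {φ : characterSpace ℂ (commResolventAlgebra X)} {l k : ℝ}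
    (hl : l ≠ 0) (hk : k ≠ 0) {x : X} (h : φ (resolventGen k hk x) = 0) :
    φ (resolventGen l hl x) = 0 := by
  rw [resolventGen_resolvent hl hk, map_add, map_smul, map_mul, h]
  simp

/-- The subspace of those `x` for which the resolvents in direction `x` are not annihilated. -/
def characterSubmodule (φ : characterSpace ℂ (commResolventAlgebra X)) : Submodule ℝ X where
  carrier := {x | φ (resolventGen 1 one_ne_zero x) ≠ 0}
  zero_mem' := by
    simp [resolventGen_zero, map_smul]
  add_mem' := by
    intro x z hx hz h
    have h2 := character_resolventGen_eq_zero (l := 1 + 1) (by norm_num) one_ne_zero h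
    have h3 := congrArg φ (resolventGen_mul one_ne_zero one_ne_zero (by norm_num) x z)
    rw [map_mul, map_mul, h2, zero_mul] at h3
    exact mul_ne_zero hx hz h3
  smul_mem' := by
    intro s x hx h
    rcases eq_or_ne s 0 with rfl | hs
    · rw [zero_smul, resolventGen_zero, map_smul, map_one] at h
      simp at h
    · have h2 := character_resolventGen_eq_zero (l := s * 1) (by simpa using hs) one_ne_zero h
      refine hx ?_
      rw [resolventGen_smul one_ne_zero hs, map_smul, h2, smul_zero]

theorem mem_characterSubmodule {φ : characterSpace ℂ (commResolventAlgebra X)} {x : X} :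
    x ∈ characterSubmodule φ ↔ φ (resolventGen 1 one_ne_zero x) ≠ 0 := Iff.rfl

/-- The value of a character at the coordinate function `y ↦ x ⬝ y`. -/
def characterCoord (φ : characterSpace ℂ (commResolventAlgebra X)) (x : X) : ℝ :=
  -((φ (resolventGen 1 one_ne_zero x))⁻¹).re

/-- By the resolvent identity the reciprocal minus `il` is independent of `l`; comparing `l = 1`
with its adjoint `l = -1` shows that this constant is real. -/
theorem inv_character_resolventGen (φ : characterSpace ℂ (commResolventAlgebra X)) {x : X}
    (hx : x ∈ characterSubmodule φ) {l : ℝ} (hl : l ≠ 0) :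
    (φ (resolventGen l hl x))⁻¹ = Complex.I * l - characterCoord φ x := by
  have hne : ∀ {k : ℝ} (hk : k ≠ 0), φ (resolventGen k hk x) ≠ 0 := fun hk h =>
    hx (character_resolventGen_eq_zero one_ne_zero hk h)
  have hdiff : ∀ {l : ℝ} (hl : l ≠ 0), (φ (resolventGen l hl x))⁻¹ =
      (φ (resolventGen 1 one_ne_zero x))⁻¹ + Complex.I * (l - 1) := fun {l} hl => by
    have h := congrArg φ (resolventGen_resolvent hl one_ne_zero x)
    rw [map_add, map_smul, map_mul, smul_eq_mul] at h
    have h1 := hne hl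
    have h2 := hne (one_ne_zero (α := ℝ))
    field_simp
    push_cast at h
    linear_combination -h
  have him : ((φ (resolventGen 1 one_ne_zero x))⁻¹).im = 1 := by
    have h1 := hdiff (neg_ne_zero.2 (one_ne_zero (α := ℝ)))
    rw [← star_resolventGen one_ne_zero, character_star, ← star_inv₀] at h1
    have h2 := congrArg Complex.im h1
    simp only [Complex.star_def, Complex.conj_im, Complex.add_im, Complex.mul_im, Complex.I_re,
      Complex.I_im] at h2
    norm_num at h2
    simp only [Complex.inv_im]
    linarith
  rw [hdiff hl]
  apply Complex.ext
  · simp [characterCoord]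
  · simp only [Complex.add_im, him]
    simp

theorem characterCoord_add (φ : characterSpace ℂ (commResolventAlgebra X)) {x z : X}
    (hx : x ∈ characterSubmodule φ) (hz : z ∈ characterSubmodule φ) :
    characterCoord φ (x + z) = characterCoord φ x + characterCoord φ z := by
  have h2 : (1 + 1 : ℝ) ≠ 0 := by norm_num
  have h := congrArg φ (resolventGen_mul one_ne_zero one_ne_zero h2 x z)
  rw [map_mul, map_mul, map_add] at h
  have e1 := inv_character_resolventGen φ hx one_ne_zero
  have e2 := inv_character_resolventGen φ hz one_ne_zero
  have e3 := inv_character_resolventGen φ (add_mem hx hz) h2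
  have n1 := mem_characterSubmodule.1 hx
  have n2 := mem_characterSubmodule.1 hz
  have n3 : φ (resolventGen (1 + 1) h2 (x + z)) ≠ 0 := fun h =>
    mem_characterSubmodule.1 (add_mem hx hz) (character_resolventGen_eq_zero one_ne_zero h2 h)
  have e : (φ (resolventGen (1 + 1) h2 (x + z)))⁻¹ =
      (φ (resolventGen 1 one_ne_zero x))⁻¹ + (φ (resolventGen 1 one_ne_zero z))⁻¹ := by
    field_simp
    linear_combination h
  rw [e1, e2, e3] at e
  have := congrArg Complex.re e
  simp at this
  linarith

theorem characterCoord_smul (φ : characterSpace ℂ (commResolventAlgebra X)) (s : ℝ) {x : X}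
    (hx : x ∈ characterSubmodule φ) :
    characterCoord φ (s • x) = s * characterCoord φ x := by
  rcases eq_or_ne s 0 with rfl | hs
  · rw [zero_smul, characterCoord, resolventGen_zero, map_smul, map_one]
    simp
  · have h := congrArg φ (resolventGen_smul one_ne_zero hs x)
    rw [map_smul, smul_eq_mul] at h
    have e1 := inv_character_resolventGen φ hx one_ne_zero
    have e2 := inv_character_resolventGen φ (Submodule.smul_mem _ s hx) (mul_ne_zero hs one_ne_zero)
    rw [h, mul_inv, e2] at e1
    have hs' : (s : ℂ) ≠ 0 := by exact_mod_cast hs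
    field_simp at e1
    have := congrArg Complex.re e1
    simp at this
    linarith

end Characters

/-! ### Characters as affine subspaces -/

section Surjective

variable {X : Type*} [NormedAddCommGroup X] [InnerProductSpace ℝ X] [FiniteDimensional ℝ X]

theorem exists_resolventValue_eq (φ : characterSpace ℂ (commResolventAlgebra X)) :
    ∃ A : Omega X, ∀ (l : ℝ) (hl : l ≠ 0) (x : X),
      φ (resolventGen l hl x) = resolventValue A l x := by
  let W := characterSubmodule φ
  let c : W →ₗ[ℝ] ℝ :=
    { toFun := fun x => characterCoord φ x
      map_add' := fun x z => characterCoord_add φ x.2 z.2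
      map_smul' := fun s x => characterCoord_smul φ s x.2 }
  let w : W := (InnerProductSpace.toDual ℝ W).symm c.toContinuousLinearMap
  have hw : ∀ x ∈ W, inner ℝ x (w : X) = characterCoord φ x := fun x hx => by
    have : inner ℝ w (⟨x, hx⟩ : W) = c.toContinuousLinearMap ⟨x, hx⟩ :=
      InnerProductSpace.toDual_symm_apply
    rw [real_inner_comm]
    exact this
  refine ⟨Omega.ofPair Wᗮ w, fun l hl x => ?_⟩
  have hw' : (w : X) ∈ Wᗮᗮ := by
    rw [Submodule.orthogonal_orthogonal]
    exact w.2
  rw [resolventValue, Omega.dir_ofPair, Omega.foot_ofPair hw', Submodule.orthogonal_orthogonal]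
  split_ifs with hx
  · rw [hw x hx, ← inv_character_resolventGen φ hx hl, one_div, inv_inv]
  · exact character_resolventGen_eq_zero hl one_ne_zero (not_not.1 hx)

theorem resolventValue_ne_zero_iff {A : Omega X} {l : ℝ} (hl : l ≠ 0) {x : X} :
    resolventValue A l x ≠ 0 ↔ x ∈ A.dirᗮ := by
  unfold resolventValue
  split_ifs with h
  · simp only [h, iff_true]
    exact one_div_ne_zero (denom_ne_zero hl _ _)
  · simp [h]

theorem eq_of_resolventValue_eq {A B : Omega X}
    (h : ∀ x, resolventValue A 1 x = resolventValue B 1 x) : A = B := by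
  have hd : A.dirᗮ = B.dirᗮ := by
    ext x
    rw [← resolventValue_ne_zero_iff one_ne_zero, h x, resolventValue_ne_zero_iff one_ne_zero]
  have hin : ∀ x ∈ A.dirᗮ, inner ℝ x A.foot = inner ℝ x B.foot := fun x hx => by
    have := h x
    rw [resolventValue, resolventValue, if_pos hx, if_pos (hd ▸ hx)] at this
    simpa using this
  have hf : A.foot = B.foot := by
    have hm : A.foot - B.foot ∈ A.dirᗮ :=
      sub_mem A.foot_mem_orthogonal (hd ▸ B.foot_mem_orthogonal)
    have := hin _ hm
    rw [← sub_eq_zero, ← inner_sub_right] at this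
    exact sub_eq_zero.1 (inner_self_eq_zero.1 this)
  have hd' : A.dir = B.dir := by
    rw [← Submodule.orthogonal_orthogonal A.dir, hd, Submodule.orthogonal_orthogonal]
  rw [← A.ofPair_dir_foot, ← B.ofPair_dir_foot, hd', hf]

end Surjective

/-- Every proper filter is refined by the tail filter of a net. -/
theorem exists_net_tendsto {α : Type} (F : Filter α) [F.NeBot] :
    ∃ (κ : Type) (_ : Preorder κ) (_ : IsDirectedOrder κ) (_ : Nonempty κ) (φ : κ → α),
      Tendsto φ atTop F := by
  -- Pointed members of `F`, ordered by reverse inclusion of the sets; the net picks the point.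
  let κ := {p : Set α × α // p.1 ∈ F ∧ p.2 ∈ p.1}
  let inst : Preorder κ := Preorder.lift fun p => OrderDual.toDual p.1.1
  have hle : ∀ p q : κ, p ≤ q ↔ q.1.1 ⊆ p.1.1 := fun p q => Iff.rfl
  have mk : ∀ s ∈ F, ∃ p : κ, p.1.1 = s := fun s hs =>
    let ⟨a, ha⟩ := F.nonempty_of_mem hs
    ⟨⟨(s, a), hs, ha⟩, rfl⟩
  have hne : Nonempty κ := let ⟨p, _⟩ := mk _ univ_mem; ⟨p⟩
  have hdir : IsDirectedOrder κ := ⟨fun p q => by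
    obtain ⟨r, hr⟩ := mk _ (inter_mem p.2.1 q.2.1)
    exact ⟨r, (hle _ _).2 (hr ▸ Set.inter_subset_left), (hle _ _).2 (hr ▸ Set.inter_subset_right)⟩⟩
  refine ⟨κ, inst, hdir, hne, fun p => p.1.2, fun s hs => ?_⟩
  obtain ⟨p, hp⟩ := mk s hs
  exact (eventually_ge_atTop p).mono fun q hq => hp ▸ (hle p q).1 hq q.2.2

/-! ### Net convergence and resolvent values -/

section Nets

variable {X : Type*} [NormedAddCommGroup X] [InnerProductSpace ℝ X] [FiniteDimensional ℝ X]

theorem tendsto_iff_forall_inner {ι : Type*} {F : Filter ι} {u : ι → X} {a : X} :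
    Tendsto u F (𝓝 a) ↔
      ∀ y, Tendsto (fun i => inner ℝ y (u i)) F (𝓝 (inner ℝ y a)) := by
  refine ⟨fun h y => tendsto_const_nhds.inner h, fun h => ?_⟩
  let b := stdOrthonormalBasis ℝ X
  have hs : Tendsto (fun i => ∑ j, inner ℝ (b j) (u i) • b j) F
      (𝓝 (∑ j, inner ℝ (b j) a • b j)) :=
    tendsto_finsetSum _ fun j _ => (h (b j)).smul_const _
  simpa only [b.sum_repr'] using hs

theorem tendsto_starProjection_iff {ι : Type*} {F : Filter ι} {u : ι → X} {K : Submodule ℝ X}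
    {a : X} (ha : a ∈ K) :
    Tendsto (fun i => K.starProjection (u i)) F (𝓝 a) ↔
      ∀ y ∈ K, Tendsto (fun i => inner ℝ y (u i)) F (𝓝 (inner ℝ y a)) := by
  have hsymm : ∀ y v : X, inner ℝ y (K.starProjection v) = inner ℝ (K.starProjection y) v :=
    fun y v => (Submodule.inner_starProjection_left_eq_right K y v).symm
  have ha' : K.starProjection a = a := Submodule.starProjection_eq_self_iff.2 ha
  rw [tendsto_iff_forall_inner]
  constructor
  · intro h y hy
    have := h y
    simp_rw [hsymm, Submodule.starProjection_eq_self_iff.2 hy] at this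
    exact this
  · intro h y
    rw [← ha']
    simp_rw [hsymm]
    exact h _ (Submodule.starProjection_apply_mem K y)

namespace Omega

theorem space_le_iff {A B : Omega X} :
    B.space ≤ A.space ↔ B.dir ≤ A.dir ∧ B.foot - A.foot ∈ A.dir := by
  constructor
  · exact fun h => ⟨AffineSubspace.direction_le h,
      AffineSubspace.vsub_mem_direction (h B.foot_mem) A.foot_mem⟩
  · rintro ⟨hd, hf⟩
    rw [← A.ofPair_dir_foot, ← B.ofPair_dir_foot]
    intro p hp
    have hp' : p - B.foot ∈ B.dir := AffineSubspace.mem_mk'.1 hp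
    refine AffineSubspace.mem_mk'.2 ?_
    have := add_mem (hd hp') hf
    rwa [sub_add_sub_cancel] at this

theorem dir_lt_of_space_lt {A B : Omega X} (h : B.space < A.space) : B.dir < A.dir := by
  obtain ⟨hd, hf⟩ := space_le_iff.1 h.le
  refine lt_of_le_not_ge hd fun hd' => h.not_ge (space_le_iff.2 ⟨hd', ?_⟩)
  rw [← neg_sub]
  exact neg_mem (hd' hf)

theorem AbsorbedIn.tendsto_resolventValue {ι : Type} [Preorder ι] {x : ι → Omega X} {A : Omega X}
    (h : AbsorbedIn x A) {l : ℝ} (hl : l ≠ 0) {y : X} (hy : y ∈ A.dirᗮ) :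
    Tendsto (fun i => resolventValue (x i) l y) atTop (𝓝 (resolventValue A l y)) := by
  have h1 := (tendsto_starProjection_iff A.foot_mem_orthogonal).1 h.1 y hy
  rw [resolventValue, if_pos hy]
  have h2 : Tendsto (fun i => 1 / (Complex.I * (l : ℂ) - ((inner ℝ y (x i).foot : ℝ) : ℂ))) atTop
      (𝓝 (1 / (Complex.I * (l : ℂ) - ((inner ℝ y A.foot : ℝ) : ℂ)))) :=
    tendsto_const_nhds.div
      (tendsto_const_nhds.sub ((Complex.continuous_ofReal.tendsto _).comp h1))
      (denom_ne_zero hl _ _)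
  refine h2.congr' ?_
  filter_upwards [h.2] with i hi
  rw [resolventValue, if_pos (Submodule.orthogonal_le hi hy)]

/-- The limit is nonzero, so the values are eventually nonzero, which forces `y ⊥ V_i`; inverting
then recovers the inner products. -/
theorem tendsto_inner_of_tendsto_resolventValue {ι : Type*} {F : Filter ι} {x : ι → Omega X}
    {A : Omega X} {y : X} (hy : y ∈ A.dirᗮ)
    (h : Tendsto (fun i => resolventValue (x i) 1 y) F (𝓝 (resolventValue A 1 y))) :
    (∀ᶠ i in F, y ∈ (x i).dirᗮ) ∧
      Tendsto (fun i => inner ℝ y (x i).foot) F (𝓝 (inner ℝ y A.foot)) := by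
  have hne : resolventValue A 1 y ≠ 0 := (resolventValue_ne_zero_iff one_ne_zero).2 hy
  have hev : ∀ᶠ i in F, y ∈ (x i).dirᗮ := (h.eventually_ne hne).mono fun i hi =>
    (resolventValue_ne_zero_iff one_ne_zero).1 hi
  refine ⟨hev, ?_⟩
  have hre : ∀ B : Omega X, y ∈ B.dirᗮ → -((resolventValue B 1 y)⁻¹).re = inner ℝ y B.foot :=
    fun B hB => by
      rw [resolventValue, if_pos hB, one_div, inv_inv]
      simp
  rw [← hre A hy]
  refine ((Complex.continuous_re.tendsto _).comp (h.inv₀ hne)).neg.congr' ?_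
  filter_upwards [hev] with i hi
  exact hre _ hi

theorem absorbedIn_of_tendsto {ι : Type} [Preorder ι] {x : ι → Omega X} {A : Omega X}
    (h : ∀ y ∈ A.dirᗮ, (∀ᶠ i in atTop, y ∈ (x i).dirᗮ) ∧
      Tendsto (fun i => inner ℝ y (x i).foot) atTop (𝓝 (inner ℝ y A.foot))) :
    AbsorbedIn x A := by
  refine ⟨(tendsto_starProjection_iff A.foot_mem_orthogonal).2 fun y hy => (h y hy).2, ?_⟩
  -- Finitely many generators turn the eventual membership of each `y` into an eventual inclusion of
  -- subspaces.
  obtain ⟨S, hS⟩ := IsNoetherian.noetherian (A.dirᗮ)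
  have hSm : ∀ y ∈ S, y ∈ A.dirᗮ := fun y hy => hS ▸ Submodule.subset_span hy
  filter_upwards [(eventually_all_finset S).2 fun y hy => (h y (hSm y hy)).1] with i hi
  have hle : A.dirᗮ ≤ (x i).dirᗮ := by
    rw [← hS]
    exact Submodule.span_le.2 hi
  have := Submodule.orthogonal_le hle
  rwa [Submodule.orthogonal_orthogonal, Submodule.orthogonal_orthogonal] at this

/-- A subnet absorbed in a smaller `B` would have a nonzero limit at some `z` in `B.dirᗮ` outside
`A.dirᗮ`, where the limit has to be `0`. -/
theorem convergesTo_of_tendsto_resolventValue {ι : Type} [Preorder ι] {x : ι → Omega X}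
    {A : Omega X}
    (h : ∀ y, Tendsto (fun i => resolventValue (x i) 1 y) atTop (𝓝 (resolventValue A 1 y))) :
    ConvergesTo x A := by
  refine ⟨absorbedIn_of_tendsto fun y hy => tendsto_inner_of_tendsto_resolventValue hy (h y), ?_⟩
  intro κ _ _ _ φ hφ B hB hxB
  obtain ⟨z, hzB, hzA⟩ : ∃ z ∈ B.dirᗮ, z ∉ A.dirᗮ := by
    by_contra! hle
    have := Submodule.orthogonal_le (show B.dirᗮ ≤ A.dirᗮ from hle)
    rw [Submodule.orthogonal_orthogonal, Submodule.orthogonal_orthogonal] at this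
    exact (dir_lt_of_space_lt hB).not_ge this
  have h1 := hxB.tendsto_resolventValue one_ne_zero hzB
  have h2 := tendsto_nhds_unique h1 ((h z).comp hφ)
  exact hzA ((resolventValue_ne_zero_iff one_ne_zero).1
    (h2 ▸ (resolventValue_ne_zero_iff one_ne_zero).2 hzB))

/-- The smaller affine subspace that absorbs a net which is absorbed in `A` and has a convergent
coordinate in a further direction `y`. -/
theorem exists_absorbing_lt {A : Omega X} {y : X} (hy : y ∉ A.dirᗮ) (c : ℝ) :
    ∃ B : Omega X, B.space < A.space ∧ ∀ {κ : Type} [Preorder κ] {x : κ → Omega X},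
      AbsorbedIn x A → (∀ᶠ i in atTop, y ∈ (x i).dirᗮ) →
        Tendsto (fun i => inner ℝ y (x i).foot) atTop (𝓝 c) → AbsorbedIn x B := by
  let K : Submodule ℝ X := A.dirᗮ ⊔ Submodule.span ℝ {y}
  have hyK : y ∈ K := Submodule.mem_sup_right (Submodule.mem_span_singleton_self y)
  let y₁ : X := A.dir.starProjection y
  have hy₁ : y₁ ∈ A.dir := Submodule.starProjection_apply_mem _ y
  have hy₀ : y - y₁ ∈ A.dirᗮ := Submodule.sub_starProjection_mem_orthogonal y
  have hyy₁ : inner ℝ y y₁ = inner ℝ y₁ y₁ := by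
    rw [← sub_eq_zero, ← inner_sub_left]
    exact (Submodule.mem_orthogonal' _ _).1 hy₀ y₁ hy₁
  have hne : inner ℝ y₁ y₁ ≠ 0 := fun h0 => hy (by
    rw [inner_self_eq_zero] at h0
    rwa [h0, sub_zero] at hy₀)
  have hy₁K : y₁ ∈ K := by
    have := sub_mem hyK (Submodule.mem_sup_left hy₀ : y - y₁ ∈ K)
    rwa [sub_sub_cancel] at this
  -- Chosen so that `y·w = c`; moving along `y₁ ∈ V` leaves the inner products with `Vᗮ` unchanged.
  let s : ℝ := (c - inner ℝ y A.foot) / inner ℝ y₁ y₁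
  let w : X := A.foot + s • y₁
  have hwK : w ∈ K :=
    add_mem (Submodule.mem_sup_left A.foot_mem_orthogonal) (K.smul_mem s hy₁K)
  have hdir : (ofPair Kᗮ w).dir = Kᗮ := dir_ofPair _ _
  have hdir' : (ofPair Kᗮ w).dirᗮ = K := by rw [hdir, Submodule.orthogonal_orthogonal]
  have hfoot : (ofPair Kᗮ w).foot = w :=
    foot_ofPair (by rwa [Submodule.orthogonal_orthogonal])
  have hKA : Kᗮ ≤ A.dir := by
    have := Submodule.orthogonal_le (le_sup_left : A.dirᗮ ≤ K)
    rwa [Submodule.orthogonal_orthogonal] at this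
  refine ⟨ofPair Kᗮ w, lt_of_le_not_ge (space_le_iff.2 ⟨hdir.trans_le hKA, ?_⟩) fun hle => ?_, ?_⟩
  · rw [hfoot, add_sub_cancel_left]
    exact A.dir.smul_mem s hy₁
  · have h1 : A.dir ≤ Kᗮ := (space_le_iff.1 hle).1.trans hdir.le
    have h2 := Submodule.orthogonal_le h1
    rw [Submodule.orthogonal_orthogonal] at h2
    exact hy (h2 hyK)
  · intro κ _ x hA hyx hc
    refine absorbedIn_of_tendsto fun z hz => ?_
    rw [hdir'] at hz
    obtain ⟨a, ha, b, hb, rfl⟩ := Submodule.mem_sup.1 hz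
    obtain ⟨r, rfl⟩ := Submodule.mem_span_singleton.1 hb
    constructor
    · filter_upwards [hA.2, hyx] with i h1 h2
      exact add_mem (Submodule.orthogonal_le h1 ha) (Submodule.smul_mem _ r h2)
    · have h1 := (tendsto_starProjection_iff A.foot_mem_orthogonal).1 hA.1 a ha
      have h2 := h1.add (hc.const_mul r)
      have haw : inner ℝ a w = inner ℝ a A.foot := by
        rw [inner_add_right, real_inner_smul_right,
          (Submodule.mem_orthogonal' _ _).1 ha y₁ hy₁, mul_zero, add_zero]
      have hyw : inner ℝ y w = c := by
        rw [inner_add_right, real_inner_smul_right, hyy₁, div_mul_cancel₀ _ hne]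
        ring
      simp_rw [inner_add_left, real_inner_smul_left]
      rw [hfoot, haw, hyw]
      exact h2

theorem ConvergesTo.tendsto_resolventValue {ι : Type} [Preorder ι] {x : ι → Omega X}
    {A : Omega X} (h : ConvergesTo x A) {l : ℝ} (hl : l ≠ 0) (y : X) :
    Tendsto (fun i => resolventValue (x i) l y) atTop (𝓝 (resolventValue A l y)) := by
  by_cases hy : y ∈ A.dirᗮ
  · exact h.1.tendsto_resolventValue hl hy
  have h0 : resolventValue A l y = 0 := if_neg hy
  by_contra hnot
  rw [h0, Metric.tendsto_nhds] at hnot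
  push Not at hnot
  obtain ⟨ε, hε, hfreq⟩ := hnot
  -- A value of modulus at least `ε` has a denominator of modulus at most `ε⁻¹`, whose real part
  -- bounds the coordinate.
  have hfreq' : ∃ᶠ i in atTop, y ∈ (x i).dirᗮ ∧ inner ℝ y (x i).foot ∈ Metric.closedBall 0 ε⁻¹ := by
    refine hfreq.mono fun i hi => ?_
    have hi : ε ≤ ‖resolventValue (x i) l y‖ := by simpa using hi
    have hyi : y ∈ (x i).dirᗮ :=
      (resolventValue_ne_zero_iff hl).1 (norm_pos_iff.1 (hε.trans_le hi))
    refine ⟨hyi, ?_⟩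
    rw [resolventValue, if_pos hyi, norm_div, norm_one, one_div] at hi
    rw [mem_closedBall_zero_iff]
    have h1 := Complex.abs_re_le_norm
      (Complex.I * (l : ℂ) - ((inner ℝ y (x i).foot : ℝ) : ℂ))
    have h2 := (le_inv_comm₀ hε (norm_pos_iff.2 (denom_ne_zero hl _ _))).1 hi
    refine le_trans ?_ h2
    simpa using h1
  have hNe := frequently_iff_neBot.1 hfreq'
  -- On an ultrafilter the bounded coordinate converges; a net along it is a subnet absorbed in a
  -- smaller space.
  let U := Ultrafilter.of (atTop ⊓ 𝓟 {i | y ∈ (x i).dirᗮ ∧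
    inner ℝ y (x i).foot ∈ Metric.closedBall 0 ε⁻¹})
  have hU : (U : Filter ι) ≤ atTop ⊓ 𝓟 {i | y ∈ (x i).dirᗮ ∧
    inner ℝ y (x i).foot ∈ Metric.closedBall 0 ε⁻¹} := Ultrafilter.of_le _
  have hUS : ∀ᶠ i in (U : Filter ι), y ∈ (x i).dirᗮ ∧
      inner ℝ y (x i).foot ∈ Metric.closedBall (0 : ℝ) ε⁻¹ :=
    hU.trans inf_le_right (mem_principal_self _)
  obtain ⟨c, -, hc⟩ := (isCompact_closedBall (0 : ℝ) ε⁻¹).ultrafilter_le_nhds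
    (U.map fun i => inner ℝ y (x i).foot)
    (le_principal_iff.2 (hUS.mono fun i hi => hi.2))
  have hc' : Tendsto (fun i => inner ℝ y (x i).foot) (U : Filter ι) (𝓝 c) := hc
  obtain ⟨B, hBA, hB⟩ := exists_absorbing_lt hy c
  obtain ⟨κ, _, _, _, φ, hφ⟩ := exists_net_tendsto (U : Filter ι)
  have hφ' : Tendsto φ atTop atTop := hφ.mono_right (hU.trans inf_le_left)
  exact h.2 κ φ hφ' B hBA
    (hB (h.1.subnet hφ') (hφ.eventually (hUS.mono fun i hi => hi.1)) (hc'.comp hφ))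

end Omega

end Nets

/-! ### The character of an affine subspace -/

section LimitCharacter

variable {X : Type*} [NormedAddCommGroup X] [InnerProductSpace ℝ X] [FiniteDimensional ℝ X]
  [MeasurableSpace X] [BorelSpace X]

/-- The limit value of `f` at infinity along `A`. -/
def limitValue (A : Omega X) (f : commResolventAlgebra X) : ℂ :=
  (exists_isLimitValue A f.2).choose

theorem isLimitValue_limitValue (A : Omega X) (f : commResolventAlgebra X) :
    IsLimitValue (f : X →ᵇ ℂ) A (limitValue A f) :=
  (exists_isLimitValue A f.2).choose_spec

/-- Taking limit values along `A` as a character of the commutative resolvent algebra. -/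
def limitCharacter (A : Omega X) : characterSpace ℂ (commResolventAlgebra X) :=
  CharacterSpace.equivAlgHom.symm
    { toFun := limitValue A
      map_one' := (isLimitValue_limitValue A 1).unique (.const 1)
      map_mul' := fun f g => (isLimitValue_limitValue A (f * g)).unique
        ((isLimitValue_limitValue A f).mul (isLimitValue_limitValue A g))
      map_zero' := (isLimitValue_limitValue A 0).unique (.const 0)
      map_add' := fun f g => (isLimitValue_limitValue A (f + g)).unique
        ((isLimitValue_limitValue A f).add (isLimitValue_limitValue A g))
      commutes' := fun r =>
        (isLimitValue_limitValue A (algebraMap ℂ (commResolventAlgebra X) r)).unique (.const r) }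

theorem limitCharacter_apply_eq_iff {A : Omega X} {f : commResolventAlgebra X} {z : ℂ} :
    limitCharacter A f = z ↔ IsLimitValue (f : X →ᵇ ℂ) A z :=
  ⟨fun h => h ▸ isLimitValue_limitValue A f, fun h => (isLimitValue_limitValue A f).unique h⟩

theorem limitCharacter_resolventGen (A : Omega X) {l : ℝ} (hl : l ≠ 0) (x : X) :
    limitCharacter A (resolventGen l hl x) = resolventValue A l x :=
  limitCharacter_apply_eq_iff.2 (isLimitValue_resolventFun A l hl x)

theorem limitCharacter_injective :
    Function.Injective (limitCharacter : Omega X → characterSpace ℂ (commResolventAlgebra X)) :=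
  fun A B h => eq_of_resolventValue_eq fun x => by
    rw [← limitCharacter_resolventGen A one_ne_zero, h, limitCharacter_resolventGen]

theorem limitCharacter_surjective :
    Function.Surjective (limitCharacter : Omega X → characterSpace ℂ (commResolventAlgebra X)) :=
  fun φ => by
    obtain ⟨A, hA⟩ := exists_resolventValue_eq φ
    exact ⟨A, character_ext fun l hl x => by rw [limitCharacter_resolventGen, hA]⟩

theorem tendsto_limitCharacter_iff {ι : Type} [Preorder ι] {x : ι → Omega X} {A : Omega X} :
    Tendsto (fun i => limitCharacter (x i)) atTop (𝓝 (limitCharacter A)) ↔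
      Omega.ConvergesTo x A := by
  rw [tendsto_character_iff]
  simp_rw [limitCharacter_resolventGen]
  exact ⟨fun h => Omega.convergesTo_of_tendsto_resolventValue fun y => h 1 one_ne_zero y,
    fun h l hl y => h.tendsto_resolventValue hl y⟩

end LimitCharacter

/-! ### The homeomorphism -/

section Homeomorph

variable {X : Type} [NormedAddCommGroup X] [InnerProductSpace ℝ X] [FiniteDimensional ℝ X]
  [MeasurableSpace X] [BorelSpace X]

theorem continuous_limitCharacter :
    Continuous (limitCharacter : Omega X → characterSpace ℂ (commResolventAlgebra X)) :=
  ⟨fun _ hO ι _ _ _ _ _ hx hxA hA =>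
    hO.isClosed_compl.mem_of_tendsto (tendsto_limitCharacter_iff.2 hxA)
      (Eventually.of_forall (f := atTop (α := ι)) hx) hA⟩

/-- A closure point of the image of `Uᶜ` is the limit of a net of characters from `Uᶜ`; the net
converges in `Ω`, so its limit is not in `U`. With `X : Type` the index set of this net stays in
`Type`, as `NetOpen` requires. -/
theorem isOpenMap_limitCharacter :
    IsOpenMap (limitCharacter : Omega X → characterSpace ℂ (commResolventAlgebra X)) := by
  intro U hU
  rw [← isClosed_compl_iff,
    ← Set.image_compl_eq ⟨limitCharacter_injective, limitCharacter_surjective⟩]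
  refine isClosed_of_closure_subset fun p hp => ?_
  obtain ⟨A, rfl⟩ := limitCharacter_surjective p
  refine ⟨A, fun hA => ?_, rfl⟩
  have hne : (comap limitCharacter (𝓝 (limitCharacter A)) ⊓ 𝓟 Uᶜ).NeBot := by
    rw [mem_closure_iff_clusterPt, ClusterPt, ← map_principal, ← Filter.push_pull'] at hp
    exact hp.of_map
  obtain ⟨κ, _, _, _, φ, hφ⟩ := exists_net_tendsto
    (comap limitCharacter (𝓝 (limitCharacter A)) ⊓ 𝓟 Uᶜ)
  have hφU : ∀ᶠ i in atTop, φ i ∉ U := tendsto_principal.1 (hφ.mono_right inf_le_right)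
  have hφA : Tendsto (limitCharacter ∘ φ) atTop (𝓝 (limitCharacter A)) :=
    tendsto_comap_iff.1 (hφ.mono_right inf_le_left)
  exact Omega.NetOpen.not_frequently hU hφU.frequently (tendsto_limitCharacter_iff.1 hφA) hA

theorem isHomeomorph_limitCharacter :
    IsHomeomorph (limitCharacter : Omega X → characterSpace ℂ (commResolventAlgebra X)) :=
  ⟨continuous_limitCharacter, isOpenMap_limitCharacter, limitCharacter_injective,
    limitCharacter_surjective⟩

theorem tendsto_omega_iff {ι : Type} [Preorder ι] {x : ι → Omega X} {A : Omega X} :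
    Tendsto x atTop (𝓝 A) ↔ Omega.ConvergesTo x A := by
  rw [isHomeomorph_limitCharacter.isEmbedding.tendsto_nhds_iff]
  exact tendsto_limitCharacter_iff

end Homeomorph

end ResolventAlg

end

open ResolventAlg in
theorem mainTheorem5 (m : ℕ) :
    -- the topology of `Ω` has the prescribed convergent nets
    (∀ (ι : Type) [Preorder ι] [IsDirectedOrder ι] [Nonempty ι]
      (x : ι → Omega (EuclideanSpace ℝ (Fin m))) (A : Omega (EuclideanSpace ℝ (Fin m))),
      Tendsto x atTop (𝓝 A) ↔ Omega.ConvergesTo x A) ∧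
    -- `χ A f` is the unique limit value of `f` along `A`, and `χ` is a homeomorphism
    ∃ χ : Omega (EuclideanSpace ℝ (Fin m)) →
        characterSpace ℂ (commResolventAlgebra (EuclideanSpace ℝ (Fin m))),
      (∀ (A : Omega (EuclideanSpace ℝ (Fin m)))
        (f : commResolventAlgebra (EuclideanSpace ℝ (Fin m))) (z : ℂ),
        χ A f = z ↔ IsLimitValue (f : EuclideanSpace ℝ (Fin m) →ᵇ ℂ) A z) ∧
      IsHomeomorph χ :=
  ⟨fun _ _ _ _ _ _ => tendsto_omega_iff, limitCharacter,
    fun _ _ _ => limitCharacter_apply_eq_iff, isHomeomorph_limitCharacter⟩
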